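/- Let $c\ge 1$. A seller offers two items to one additive buyer whose value $v=(v_1,v_2)$ is uniformly distributed on the triangle $T=\{v\in\mathbb R^2 : v_1\ge 0,\ v_2\ge 0,\ v_1/c+v_2\le 1\}$. An outcome $[(x_1,x_2),p]$ consists of allocation probabilities and a payment, and gives type $v$ the utility $v_1x_1+v_2x_2-p$. A mechanism assigns to each $v\in T$ an outcome $[x(v),p(v)]$ with $x(v)\in[0,1]^2$ and $p(v)\in\mathbb R$; it is IC if no type in $T$ gains by reporting another type in $T$, and IR if every type in $T$ has nonnegative utility. The payment $p$ of every IC and IR mechanism is integrable, and the revenue is $\mathbb E[p(v)]$. Call a menu (a set of outcomes) optimal if utility-maximizing choices from it exist for all types and if, whenever every type in $T$ receives an item of the menu that maximizes its utility (with ties broken arbitrarily), the resulting mechanism is IC and IR and its revenue is at least that of every IC and IR mechanism. 1. If $c\le \frac43$, the menu with the two items $[(0,0),0]$ and $\bigl[(1,1),\sqrt{c/3}\bigr]$ (sell the bundle at price $\sqrt{c/3}$) is optimal. 2. If $c>\frac43$, the menu with the three items $[(0,0),0]$, $\bigl[(\frac1c,1),\frac23\bigr]$ and $\bigl[(1,1),\frac23c-\frac13\sqrt{c(c-1)}\bigr]$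 is optimal, and its revenue (however ties are broken) is $\frac{2}{27}\bigl(4+c+\sqrt{c(c-1)}\bigr)$. -/

import Mathlib

open MeasureTheory

noncomputable section

namespace TriangleAuction

/-- The value of the buyer for each of the two items. -/
abbrev BuyerType := ℝ × ℝ

/-- An outcome, or menu item, `[(x₁, x₂), p]`: the probabilities with which the two items are
allocated, and the payment from the buyer to the seller. -/
abbrev Outcome := (ℝ × ℝ) × ℝ

/-- Quasi-linear utility of an additive buyer. -/
def utility (v : BuyerType) (o : Outcome) : ℝ :=
  v.1 * o.1.1 + v.2 * o.1.2 - o.2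

/-- `m` is a direct mechanism on the type space `V` that is incentive compatible and individually
rational. The values of `m` outside `V` play no role. Payments may be of either sign, so the
mechanisms with nonnegative payments are among these. -/
structure IsICIR (V : Set BuyerType) (m : BuyerType → Outcome) : Prop where
  feasible₁ : ∀ v ∈ V, (m v).1.1 ∈ Set.Icc (0 : ℝ) 1
  feasible₂ : ∀ v ∈ V, (m v).1.2 ∈ Set.Icc (0 : ℝ) 1
  ic : ∀ v ∈ V, ∀ v' ∈ V, utility v (m v') ≤ utility v (m v)
  ir : ∀ v ∈ V, 0 ≤ utility v (m v)

/-- Expected revenue of `m` when the type of the buyer is distributed according to `μ`. -/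
def revenue (μ : Measure BuyerType) (m : BuyerType → Outcome) : ℝ :=
  ∫ v, (m v).2 ∂μ

/-- `m` is the outcome of offering the menu `M` to a rational buyer: every type in `V` receives an
item of the menu that maximizes its utility (with ties broken arbitrarily). -/
def Implements (V : Set BuyerType) (M : Set Outcome) (m : BuyerType → Outcome) : Prop :=
  ∀ v ∈ V, m v ∈ M ∧ ∀ o ∈ M, utility v o ≤ utility v (m v)

/-- The menu `M` is revenue-optimal: a rational buyer has a best choice, and however ties are
broken the resulting mechanism is IC and IR and no IC and IR mechanism earns more. -/
def IsOptimalMenu (V : Set BuyerType) (μ : Measure BuyerType) (M : Set Outcome) : Prop :=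
  (∃ m, Implements V M m) ∧
    ∀ m, Implements V M m →
      IsICIR V m ∧ ∀ m', IsICIR V m' → revenue μ m' ≤ revenue μ m

/-- The triangle with vertices `(0, 0)`, `(c, 0)` and `(0, 1)`. -/
def triangle (c : ℝ) : Set BuyerType :=
  {v | v.1 / c + v.2 ≤ 1 ∧ 0 ≤ v.1 ∧ 0 ≤ v.2}

/-- The uniform distribution on the triangle: normalized planar Lebesgue measure. -/
def uniformTriangle (c : ℝ) : Measure BuyerType :=
  ProbabilityTheory.cond volume (triangle c)

end TriangleAuction

end

open MeasureTheory

noncomputable section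

namespace TriangleAuction

open Set

/-! The payment is `v · x - U`, with `U` the indirect utility and `x` a subgradient of it.
Integrating by parts along horizontal and vertical slices of the triangle turns revenue into a
linear functional of `U` alone: up to the factor `2 / c`, it is `c` times the integral of `U` over
the hypotenuse, parametrized by `σ ∈ [0, 1]`, minus three times its integral over the triangle
(`IsICIR.setIntegral_payment`).

Let `g = U' - U` compare a competitor with the proposed menu. Where the menu sells nothing, `U = 0`
and `g ≥ 0`, so it suffices to show that `c` times the hypotenuse integral of `g` is at most three
times its integral over the region `R` where something is sold. The prices make the area of `R`
equal to `c / 3`, so the two sides have equal mass and, by the layer-cake formula, only sublevel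
sets of `g` need comparing (`volume_sublevel_le`).

To the left of the threshold, `g` is nonincreasing in `v₂`, and the vertical sections of `R` have
constant length `1 / 3`. In the bundle region `g` is nonincreasing in both coordinates and convex
along the hypotenuse, so a sublevel set meets the hypotenuse in an interval and lies in the part of
the region spanned by that interval; the area bound `volume_bundleRegion_le` finishes. What remains
is to check the polynomial conditions `OptimalPricing` for the two price choices. -/

/-! ### Layer-cake comparison and areas of planar regions. -/

/-- Comparison of integrals of nonnegative functions through their superlevel sets. -/
lemma integral_le_of_superlevel {α β : Type*} [MeasurableSpace α] [MeasurableSpace β]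
    {μ : Measure α} {ν : Measure β} {f : α → ℝ} {g : β → ℝ}
    (hf : Integrable f μ) (hg : Integrable g ν) (hf0 : 0 ≤ᵐ[μ] f) (hg0 : 0 ≤ᵐ[ν] g)
    (h : ∀ t, μ {a | t < f a} ≤ ν {b | t < g b}) : ∫ a, f a ∂μ ≤ ∫ b, g b ∂ν := by
  rw [← ENNReal.ofReal_le_ofReal_iff (integral_nonneg_of_ae hg0),
    ofReal_integral_eq_lintegral_ofReal hf hf0, ofReal_integral_eq_lintegral_ofReal hg hg0,
    lintegral_eq_lintegral_meas_lt μ hf0 hf.aemeasurable,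
    lintegral_eq_lintegral_meas_lt ν hg0 hg.aemeasurable]
  exact lintegral_mono fun t => h t

lemma measurable_div_add (k : ℝ) : Measurable fun v : ℝ × ℝ => v.1 / k + v.2 :=
  (measurable_fst.div_const k).add measurable_snd

/-- The right triangle with corner `(a, b)` below the line `x / k + y = d`. -/
def cornerTriangle (a b k d : ℝ) : Set (ℝ × ℝ) := {v | a ≤ v.1 ∧ b ≤ v.2 ∧ v.1 / k + v.2 ≤ d}

lemma measurableSet_cornerTriangle (a b k d : ℝ) : MeasurableSet (cornerTriangle a b k d) := by
  unfold cornerTriangle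
  refine (measurableSet_le measurable_const measurable_fst).inter
    ((measurableSet_le measurable_const measurable_snd).inter
      (measurableSet_le (measurable_div_add _) measurable_const))

lemma volume_cornerTriangle {a b k d r : ℝ} (hk : 0 < k) (hr : 0 ≤ r)
    (h : d - a / k - b = r) : volume (cornerTriangle a b k d) = ENNReal.ofReal (k * r ^ 2 / 2) := by
  rw [Measure.volume_eq_prod, Measure.prod_apply (measurableSet_cornerTriangle a b k d)]
  have hsec : ∀ x, volume (Prod.mk x ⁻¹' cornerTriangle a b k d) =
      (Icc a (a + k * r)).indicator (fun x => ENNReal.ofReal (d - x / k - b)) x := by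
    intro x
    have hlin : d - x / k - b = r - (x - a) / k := by rw [← h]; ring
    by_cases hx : x ∈ Icc a (a + k * r)
    · rw [indicator_of_mem hx]
      have : Prod.mk x ⁻¹' cornerTriangle a b k d = Icc b (d - x / k) := by
        ext y
        simp only [cornerTriangle, mem_preimage, mem_ofPred_eq, mem_Icc]
        exact ⟨fun h => ⟨h.2.1, by linarith [h.2.2]⟩, fun h => ⟨hx.1, h.1, by linarith [h.2]⟩⟩
      rw [this, Real.volume_Icc]
    · rw [indicator_of_notMem hx]
      have : Prod.mk x ⁻¹' cornerTriangle a b k d = ∅ := by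
        ext y
        simp only [cornerTriangle, mem_preimage, mem_ofPred_eq, mem_empty_iff_false, iff_false]
        rintro ⟨h1, h2, h3⟩
        refine hx ⟨h1, ?_⟩
        have : (x - a) / k ≤ r := by linarith
        rw [div_le_iff₀ hk] at this
        linarith
      rw [this, measure_empty]
  simp_rw [hsec]
  rw [lintegral_indicator measurableSet_Icc, ← ofReal_integral_eq_lintegral_ofReal]
  · congr 1
    rw [integral_Icc_eq_integral_Ioc,
      ← intervalIntegral.integral_of_le (by nlinarith : a ≤ a + k * r)]
    have : ∀ x ∈ uIcc a (a + k * r), HasDerivAt (fun x => d * x - x ^ 2 / 2 / k - b * x)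
        (d - x / k - b) x := by
      intro x _
      have h1 := ((((hasDerivAt_id x).const_mul d).sub
        (((((hasDerivAt_id x).pow 2).div_const 2)).div_const k))).sub
          ((hasDerivAt_id x).const_mul b)
      refine HasDerivAt.congr_deriv (f' := _) h1 ?_
      simp only [id, Nat.cast_ofNat]
      ring
    rw [intervalIntegral.integral_eq_sub_of_hasDerivAt this
      (Continuous.intervalIntegrable (by fun_prop) _ _)]
    rw [← h]; field_simp; ring
  · exact (Continuous.continuousOn (by fun_prop)).integrableOn_Icc
  · refine (ae_restrict_iff' measurableSet_Icc).2 (.of_forall fun x hx => ?_)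
    have : (x - a) / k ≤ r := by rw [div_le_iff₀ hk]; linarith [hx.2]
    have hlin : d - x / k - b = r - (x - a) / k := by rw [← h]; ring
    simp only [Pi.zero_apply]; linarith

/-- Every nonempty vertical section has length `1 - 2 / 3`, whatever `S` is. This is what matches
sets in the left region with subsets of the hypotenuse at the rate `c / 3`. -/
lemma volume_strip {c : ℝ} (hc : 0 < c) {S : Set ℝ} (hS : MeasurableSet S) :
    volume {v : ℝ × ℝ | v.1 / c ∈ S ∧ 2 / 3 < v.1 / c + v.2 ∧ v.1 / c + v.2 ≤ 1} =
      ENNReal.ofReal (c / 3) * volume S := by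
  have hmeas : Measurable fun x : ℝ => x / c := by fun_prop
  have hm : MeasurableSet
      {v : ℝ × ℝ | v.1 / c ∈ S ∧ 2 / 3 < v.1 / c + v.2 ∧ v.1 / c + v.2 ≤ 1} :=
    ((hmeas.comp measurable_fst) hS).inter
      ((measurableSet_lt measurable_const (measurable_div_add _)).inter
        (measurableSet_le (measurable_div_add _) measurable_const))
  rw [Measure.volume_eq_prod, Measure.prod_apply hm]
  have hsec : ∀ x : ℝ, volume (Prod.mk x ⁻¹'
      {v : ℝ × ℝ | v.1 / c ∈ S ∧ 2 / 3 < v.1 / c + v.2 ∧ v.1 / c + v.2 ≤ 1}) =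
      ((fun x => x / c) ⁻¹' S).indicator (fun _ => ENNReal.ofReal (1 / 3)) x := by
    intro x
    by_cases hx : x / c ∈ S
    · rw [indicator_of_mem (by exact hx)]
      have : Prod.mk x ⁻¹'
          {v : ℝ × ℝ | v.1 / c ∈ S ∧ 2 / 3 < v.1 / c + v.2 ∧ v.1 / c + v.2 ≤ 1} =
          Ioc (2 / 3 - x / c) (1 - x / c) := by
        ext y
        simp only [mem_preimage, mem_ofPred_eq, mem_Ioc]
        exact ⟨fun h => ⟨by linarith [h.2.1], by linarith [h.2.2]⟩,
          fun h => ⟨hx, by linarith [h.1], by linarith [h.2]⟩⟩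
      rw [this, Real.volume_Ioc]
      congr 1; ring
    · rw [indicator_of_notMem (by exact hx)]
      have : Prod.mk x ⁻¹'
          {v : ℝ × ℝ | v.1 / c ∈ S ∧ 2 / 3 < v.1 / c + v.2 ∧ v.1 / c + v.2 ≤ 1} = ∅ := by
        ext y; simp [hx]
      rw [this, measure_empty]
  simp_rw [hsec]
  rw [lintegral_indicator (hmeas hS), setLIntegral_const]
  have : (fun x : ℝ => x / c) = (fun x => x * c⁻¹) := by ext; rw [div_eq_mul_inv]
  rw [this, Real.volume_preimage_mul_right (inv_ne_zero hc.ne'), inv_inv, abs_of_pos hc,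
    ← mul_assoc, ← ENNReal.ofReal_mul (by norm_num)]
  congr 2; ring

lemma volume_line_eq_zero (k d : ℝ) : volume {v : ℝ × ℝ | v.1 / k + v.2 = d} = 0 := by
  rw [Measure.volume_eq_prod,
    Measure.measure_prod_null (measurableSet_eq_fun (measurable_div_add _) measurable_const)]
  refine .of_forall fun x => ?_
  have : Prod.mk x ⁻¹' {v : ℝ × ℝ | v.1 / k + v.2 = d} = {d - x / k} := by
    ext y
    simp only [mem_preimage, mem_ofPred_eq, mem_singleton_iff]
    exact ⟨fun h => by linarith, fun h => by linarith⟩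
  show volume (Prod.mk x ⁻¹' {v : ℝ × ℝ | v.1 / k + v.2 = d}) = 0
  rw [this]; simp

lemma volume_vertical_line_eq_zero (a : ℝ) : volume {v : ℝ × ℝ | v.1 = a} = 0 := by
  have : {v : ℝ × ℝ | v.1 = a} = {a} ×ˢ univ := by ext; simp
  rw [this, Measure.volume_eq_prod, Measure.prod_prod]
  simp

/-! ### One-dimensional integration by parts with subgradients. -/

/-- Integration by parts for a convex function given through a selection of subgradients. -/
lemma integral_mul_subgradient {A : ℝ} (hA : 0 ≤ A) {φ s : ℝ → ℝ}
    (hφ : ContinuousOn φ (Icc 0 A))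
    (h : ∀ x ∈ Icc 0 A, ∀ y ∈ Icc 0 A, φ x + s x * (y - x) ≤ φ y) :
    ∫ x in (0 : ℝ)..A, x * s x = A * φ A - ∫ x in (0 : ℝ)..A, φ x := by
  have hmono : MonotoneOn s (Icc 0 A) := by
    intro x hx y hy hxy
    rcases hxy.eq_or_lt with rfl | hlt
    · rfl
    · have h1 := h x hx y hy
      have h2 := h y hy x hx
      by_contra! hc
      nlinarith [mul_pos (sub_pos.2 hlt) (sub_pos.2 hc)]
  have hsint : IntervalIntegrable s volume 0 A :=
    MonotoneOn.intervalIntegrable (by rwa [uIcc_of_le hA])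
  have hφint : IntervalIntegrable φ volume 0 A :=
    ContinuousOn.intervalIntegrable (by rwa [uIcc_of_le hA])
  have hxs : IntervalIntegrable (fun x => x * s x) volume 0 A :=
    hsint.continuousOn_mul continuousOn_id
  -- A monotone `s` has countably many discontinuities; wherever `s` is continuous, `φ` is
  -- differentiable with derivative `s`.
  have hcount := hmono.countable_not_continuousWithinAt
  have key := integral_eq_of_hasDerivAt_off_countable_of_le
    (fun x => x * φ x) (fun x => φ x + x * s x) hA hcount (continuousOn_id.mul hφ)
    (fun x hx => ?_) (hφint.add hxs)
  · rw [intervalIntegral.integral_add hφint hxs] at key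
    simp only [zero_mul, sub_zero] at key
    linarith
  · have hxI : x ∈ Icc 0 A := Ioo_subset_Icc_self hx.1
    have hcw : ContinuousWithinAt s (Icc 0 A) x := by
      by_contra hn; exact hx.2 ⟨hxI, hn⟩
    have hnhds : Icc 0 A ∈ nhds x := Icc_mem_nhds hx.1.1 hx.1.2
    have hca : ContinuousAt s x := hcw.continuousAt hnhds
    have hd : HasDerivAt φ (s x) x := by
      rw [hasDerivAt_iff_isLittleO, Asymptotics.isLittleO_iff]
      intro ε hε
      filter_upwards [hnhds, Metric.continuousAt_iff'.1 hca ε hε] with y hy hsy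
      have h1 := h x hxI y hy
      have h2 := h y hy x hxI
      rw [Real.dist_eq] at hsy
      rw [smul_eq_mul, Real.norm_eq_abs, Real.norm_eq_abs, abs_of_nonneg (by linarith)]
      calc φ y - φ x - (y - x) * s x ≤ (s y - s x) * (y - x) := by linarith
        _ ≤ |s y - s x| * |y - x| := by rw [← abs_mul]; exact le_abs_self _
        _ ≤ ε * |y - x| := by gcongr
    have := (hasDerivAt_id x).mul hd
    exact this.congr_deriv (by simp)

/-! ### Geometry of the type triangle and Fubini. -/

lemma triangle_eq_cornerTriangle (c : ℝ) : triangle c = cornerTriangle 0 0 c 1 := by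
  ext v
  simp only [triangle, cornerTriangle, mem_ofPred_eq]
  tauto

lemma measurableSet_triangle (c : ℝ) : MeasurableSet (triangle c) :=
  triangle_eq_cornerTriangle c ▸ measurableSet_cornerTriangle 0 0 c 1

lemma volume_triangle {c : ℝ} (hc : 0 < c) : volume (triangle c) = ENNReal.ofReal (c / 2) := by
  rw [triangle_eq_cornerTriangle, volume_cornerTriangle hc zero_le_one (by simp)]
  simp

lemma isFiniteMeasure_restrict_triangle {c : ℝ} (hc : 0 < c) :
    IsFiniteMeasure ((volume : Measure BuyerType).restrict (triangle c)) :=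
  ⟨by simp [volume_triangle hc]⟩

lemma mem_triangle {c : ℝ} {v : ℝ × ℝ} :
    v ∈ triangle c ↔ v.1 / c + v.2 ≤ 1 ∧ 0 ≤ v.1 ∧ 0 ≤ v.2 := Iff.rfl

lemma fst_le_of_mem_triangle {c : ℝ} (hc : 0 < c) {v : ℝ × ℝ} (hv : v ∈ triangle c) :
    v.1 ≤ c := by
  have : v.1 / c ≤ 1 := by linarith [hv.1, hv.2.2]
  rwa [div_le_one hc] at this

lemma snd_le_of_mem_triangle {c : ℝ} (hc : 0 < c) {v : ℝ × ℝ} (hv : v ∈ triangle c) :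
    v.2 ≤ 1 := by
  have : 0 ≤ v.1 / c := div_nonneg hv.2.1 hc.le
  linarith [hv.1]

lemma hypotenuse_mem_triangle {c : ℝ} (hc : 0 < c) {σ : ℝ} (hσ : σ ∈ Icc (0 : ℝ) 1) :
    (c * σ, 1 - σ) ∈ triangle c := by
  refine ⟨?_, mul_nonneg hc.le hσ.1, by simpa using hσ.2⟩
  simp [mul_div_cancel_left₀ _ hc.ne']

lemma convex_triangle (c : ℝ) : Convex ℝ (triangle c) := by
  rintro v ⟨hv1, hv2, hv3⟩ w ⟨hw1, hw2, hw3⟩ a b ha hb hab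
  refine ⟨?_, ?_, ?_⟩
  · have : (a • v + b • w).1 / c + (a • v + b • w).2 =
        a * (v.1 / c + v.2) + b * (w.1 / c + w.2) := by simp; ring
    rw [this]; nlinarith
  · simp; positivity
  · simp; positivity

/-- Fubini's theorem on the triangle, by vertical slices. -/
lemma setIntegral_triangle {c : ℝ} (hc : 0 < c) {f : ℝ × ℝ → ℝ}
    (hf : IntegrableOn f (triangle c)) :
    ∫ v in triangle c, f v = ∫ x in (0 : ℝ)..c, ∫ y in (0 : ℝ)..(1 - x / c), f (x, y) := by
  rw [← integral_indicator (measurableSet_triangle c), Measure.volume_eq_prod,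
    integral_prod _ ((integrable_indicator_iff (measurableSet_triangle c)).2 hf),
    intervalIntegral.integral_of_le hc.le, ← integral_Icc_eq_integral_Ioc,
    ← integral_indicator measurableSet_Icc]
  congr 1; ext x
  by_cases hx : x ∈ Icc 0 c
  · have h1 : 0 ≤ 1 - x / c := by
      rw [sub_nonneg, div_le_one hc]; exact hx.2
    rw [indicator_of_mem hx, intervalIntegral.integral_of_le h1, ← integral_Icc_eq_integral_Ioc,
      ← integral_indicator measurableSet_Icc]
    congr 1; ext y
    have : (x, y) ∈ triangle c ↔ y ∈ Icc 0 (1 - x / c) := by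
      rw [mem_triangle]
      exact ⟨fun h => ⟨h.2.2, by linarith [h.1]⟩, fun h => ⟨by linarith [h.2], hx.1, h.1⟩⟩
    by_cases hy : y ∈ Icc 0 (1 - x / c)
    · rw [indicator_of_mem hy, indicator_of_mem (this.2 hy)]
    · rw [indicator_of_notMem hy, indicator_of_notMem (fun h => hy (this.1 h))]
  · rw [indicator_of_notMem hx]
    have : ∀ y, (triangle c).indicator f (x, y) = 0 := fun y =>
      indicator_of_notMem (fun h => hx ⟨h.2.1, fst_le_of_mem_triangle hc h⟩) _
    simp [this]

/-- Fubini's theorem on the triangle, by horizontal slices. -/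
lemma setIntegral_triangle_symm {c : ℝ} (hc : 0 < c) {f : ℝ × ℝ → ℝ}
    (hf : IntegrableOn f (triangle c)) :
    ∫ v in triangle c, f v = ∫ y in (0 : ℝ)..1, ∫ x in (0 : ℝ)..(c * (1 - y)), f (x, y) := by
  rw [← integral_indicator (measurableSet_triangle c), Measure.volume_eq_prod,
    integral_prod_symm _ ((integrable_indicator_iff (measurableSet_triangle c)).2 hf),
    intervalIntegral.integral_of_le zero_le_one, ← integral_Icc_eq_integral_Ioc,
    ← integral_indicator measurableSet_Icc]
  congr 1; ext y
  by_cases hy : y ∈ Icc (0 : ℝ) 1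
  · have h1 : 0 ≤ c * (1 - y) := mul_nonneg hc.le (by linarith [hy.2])
    rw [indicator_of_mem hy, intervalIntegral.integral_of_le h1, ← integral_Icc_eq_integral_Ioc,
      ← integral_indicator measurableSet_Icc]
    congr 1; ext x
    have : (x, y) ∈ triangle c ↔ x ∈ Icc 0 (c * (1 - y)) := by
      rw [mem_triangle, mem_Icc, ← le_sub_iff_add_le, div_le_iff₀ hc, mul_comm c]
      exact ⟨fun h => ⟨h.2.1, h.1⟩, fun h => ⟨h.2, h.1, hy.1⟩⟩
    by_cases hx : x ∈ Icc 0 (c * (1 - y))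
    · rw [indicator_of_mem hx, indicator_of_mem (this.2 hx)]
    · rw [indicator_of_notMem hx, indicator_of_notMem (fun h => hx (this.1 h))]
  · rw [indicator_of_notMem hy]
    have : ∀ x, (triangle c).indicator f (x, y) = 0 := fun x =>
      indicator_of_notMem (fun h => hy ⟨h.2.2, snd_le_of_mem_triangle hc h⟩) _
    simp [this]

/-! ### Regularity of the indirect utility and the allocation. -/

namespace IsICIR

variable {V : Set BuyerType} {m : BuyerType → Outcome}

/-- The allocation is a subgradient of the indirect utility. -/
lemma subgradient (h : IsICIR V m) {v w : BuyerType} (hv : v ∈ V) (hw : w ∈ V) :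
    utility v (m v) + (m v).1.1 * (w.1 - v.1) + (m v).1.2 * (w.2 - v.2) ≤ utility w (m w) := by
  have := h.ic w hw v hv
  simp only [utility] at *
  linarith

/-- Subgradients in `[0, 1]²` give constant `2` for the sup distance. Extending to the whole plane
makes continuity and Rademacher's theorem available. -/
lemma exists_lipschitz (h : IsICIR V m) :
    ∃ U : BuyerType → ℝ, LipschitzWith 2 U ∧ ∀ v ∈ V, U v = utility v (m v) := by
  have hL : LipschitzOnWith 2 (fun v => utility v (m v)) V := by
    refine LipschitzOnWith.of_le_add_mul 2 fun v hv w hw => ?_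
    have h1 := h.subgradient hv hw
    have hx := h.feasible₁ v hv
    have hy := h.feasible₂ v hv
    have d1 : |v.1 - w.1| ≤ dist v w := by rw [← Real.dist_eq]; exact le_max_left _ _
    have d2 : |v.2 - w.2| ≤ dist v w := by rw [← Real.dist_eq]; exact le_max_right _ _
    have e1 : (m v).1.1 * (v.1 - w.1) ≤ |v.1 - w.1| := by
      nlinarith [le_abs_self (v.1 - w.1), abs_nonneg (v.1 - w.1), hx.1, hx.2]
    have e2 : (m v).1.2 * (v.2 - w.2) ≤ |v.2 - w.2| := by
      nlinarith [le_abs_self (v.2 - w.2), abs_nonneg (v.2 - w.2), hy.1, hy.2]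
    have : ((2 : NNReal) : ℝ) = 2 := rfl
    rw [this]
    linarith
  obtain ⟨U, hU, hE⟩ := hL.extend_real
  exact ⟨U, hU, fun v hv => (hE hv).symm⟩

/-- The allocation is almost everywhere the gradient of the indirect utility. -/
lemma ae_eq_fderiv (h : IsICIR V m) (hV : Convex ℝ V) (hVm : MeasurableSet V)
    {U : BuyerType → ℝ} (hU : LipschitzWith 2 U) (hUV : ∀ v ∈ V, U v = utility v (m v)) :
    ∀ᵐ v ∂volume.restrict V,
      (m v).1.1 = fderiv ℝ U v (1, 0) ∧ (m v).1.2 = fderiv ℝ U v (0, 1) := by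
  rw [ae_restrict_iff' hVm]
  have hfr : ∀ᵐ v ∂(volume : Measure BuyerType), v ∉ frontier V :=
    measure_eq_zero_iff_ae_notMem.1 (hV.addHaar_frontier volume)
  filter_upwards [hU.ae_differentiableAt (μ := volume), hfr] with v hd hv hvV
  have hint : v ∈ interior V := by
    by_contra hn
    exact hv ⟨subset_closure hvV, hn⟩
  let L : BuyerType →L[ℝ] ℝ := (m v).1.1 • ContinuousLinearMap.fst ℝ ℝ ℝ +
    (m v).1.2 • ContinuousLinearMap.snd ℝ ℝ ℝ
  -- The subgradient inequality makes `v` minimize `U - L`, so `U` and `L` have equal derivatives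
  -- there.
  have hmin : IsLocalMin (fun w => U w - L w) v := by
    filter_upwards [mem_interior_iff_mem_nhds.1 hint] with w hw
    have := h.subgradient hvV hw
    simp only [L, add_apply, smul_apply,
      ContinuousLinearMap.coe_fst', ContinuousLinearMap.coe_snd', smul_eq_mul]
    rw [hUV v hvV, hUV w hw]
    linarith
  have h0 := hmin.fderiv_eq_zero
  rw [fderiv_fun_sub hd L.differentiableAt, L.fderiv, sub_eq_zero] at h0
  rw [h0]
  simp [L]

/-- Mechanisms are not assumed measurable; measurability comes from the a.e. identification with
partial derivatives of a Lipschitz function. -/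
lemma aestronglyMeasurable_allocation {c : ℝ} (h : IsICIR (triangle c) m) :
    AEStronglyMeasurable (fun v => (m v).1.1) (volume.restrict (triangle c)) ∧
      AEStronglyMeasurable (fun v => (m v).1.2) (volume.restrict (triangle c)) := by
  obtain ⟨U, hU, hUV⟩ := h.exists_lipschitz
  have hae := h.ae_eq_fderiv (convex_triangle c) (measurableSet_triangle c) hU hUV
  exact ⟨⟨_, (measurable_fderiv_apply_const ℝ U _).stronglyMeasurable, hae.mono fun v hv => hv.1⟩,
    ⟨_, (measurable_fderiv_apply_const ℝ U _).stronglyMeasurable, hae.mono fun v hv => hv.2⟩⟩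

lemma integrableOn_value_fst {c : ℝ} (hc : 0 < c) (h : IsICIR (triangle c) m) :
    IntegrableOn (fun v => v.1 * (m v).1.1) (triangle c) := by
  have := isFiniteMeasure_restrict_triangle hc
  refine Integrable.of_bound
    (measurable_fst.aestronglyMeasurable.mul h.aestronglyMeasurable_allocation.1) c ?_
  refine (ae_restrict_iff' (measurableSet_triangle c)).2 (.of_forall fun v hv => ?_)
  have hx := h.feasible₁ v hv
  rw [Real.norm_eq_abs, abs_of_nonneg (mul_nonneg hv.2.1 hx.1)]
  nlinarith [fst_le_of_mem_triangle hc hv, hx.1, hx.2, hv.2.1]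

lemma integrableOn_value_snd {c : ℝ} (hc : 0 < c) (h : IsICIR (triangle c) m) :
    IntegrableOn (fun v => v.2 * (m v).1.2) (triangle c) := by
  have := isFiniteMeasure_restrict_triangle hc
  refine Integrable.of_bound
    (measurable_snd.aestronglyMeasurable.mul h.aestronglyMeasurable_allocation.2) 1 ?_
  refine (ae_restrict_iff' (measurableSet_triangle c)).2 (.of_forall fun v hv => ?_)
  have hx := h.feasible₂ v hv
  rw [Real.norm_eq_abs, abs_of_nonneg (mul_nonneg hv.2.2 hx.1)]
  nlinarith [snd_le_of_mem_triangle hc hv, hx.1, hx.2, hv.2.2]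

end IsICIR

lemma integrableOn_triangle_of_continuous {c : ℝ} (hc : 0 < c) {U : BuyerType → ℝ}
    (hU : Continuous U) : IntegrableOn U (triangle c) := by
  have hsub : triangle c ⊆ Icc (0, 0) (c, 1) := fun v hv =>
    ⟨⟨hv.2.1, hv.2.2⟩, ⟨fst_le_of_mem_triangle hc hv, snd_le_of_mem_triangle hc hv⟩⟩
  exact (hU.continuousOn.integrableOn_compact isCompact_Icc).mono_set hsub

/-! ### Revenue as a functional of the indirect utility. -/

namespace IsICIR

variable {m : BuyerType → Outcome} {c : ℝ}

lemma integrableOn_payment (hc : 0 < c) (h : IsICIR (triangle c) m) :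
    IntegrableOn (fun v => (m v).2) (triangle c) := by
  obtain ⟨U, hU, hUV⟩ := h.exists_lipschitz
  refine (((h.integrableOn_value_fst hc).add (h.integrableOn_value_snd hc)).sub
    (integrableOn_triangle_of_continuous hc hU.continuous)).congr_fun (fun v hv => ?_)
      (measurableSet_triangle c)
  simp only [Pi.add_apply, Pi.sub_apply, hUV v hv, utility]
  ring

/-- The integral of the payment depends only on the indirect utility. -/
lemma setIntegral_payment (hc : 0 < c) (h : IsICIR (triangle c) m)
    {U : BuyerType → ℝ} (hU : Continuous U) (hUV : ∀ v ∈ triangle c, U v = utility v (m v)) :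
    ∫ v in triangle c, (m v).2 =
      c * (∫ σ in (0 : ℝ)..1, U (c * σ, 1 - σ)) - 3 * ∫ v in triangle c, U v := by
  have hUi := integrableOn_triangle_of_continuous hc hU
  have e0 : ∫ v in triangle c, (m v).2 = (∫ v in triangle c, v.1 * (m v).1.1) +
      (∫ v in triangle c, v.2 * (m v).1.2) - ∫ v in triangle c, U v := by
    rw [← integral_add (h.integrableOn_value_fst hc) (h.integrableOn_value_snd hc),
      ← integral_sub (f := fun v : BuyerType => v.1 * (m v).1.1 + v.2 * (m v).1.2)
        ((h.integrableOn_value_fst hc).add (h.integrableOn_value_snd hc)) hUi]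
    refine setIntegral_congr_fun (measurableSet_triangle c) fun v hv => ?_
    simp only [hUV v hv, utility]
    ring
  have e1 : ∫ v in triangle c, v.1 * (m v).1.1 =
      c * (∫ σ in (0 : ℝ)..1, σ * U (c * σ, 1 - σ)) - ∫ v in triangle c, U v := by
    rw [setIntegral_triangle_symm hc (h.integrableOn_value_fst hc),
      setIntegral_triangle_symm hc hUi]
    have hslice : ∀ y ∈ uIcc (0 : ℝ) 1, ∫ x in (0 : ℝ)..(c * (1 - y)), x * (m (x, y)).1.1 =
        c * (1 - y) * U (c * (1 - y), y) - ∫ x in (0 : ℝ)..(c * (1 - y)), U (x, y) := by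
      intro y hy
      rw [uIcc_of_le zero_le_one] at hy
      have hA : 0 ≤ c * (1 - y) := mul_nonneg hc.le (by linarith [hy.2])
      have hmem : ∀ x ∈ Icc 0 (c * (1 - y)), (x, y) ∈ triangle c := by
        intro x hx
        rw [mem_triangle, ← le_sub_iff_add_le, div_le_iff₀ hc, mul_comm]
        exact ⟨hx.2, hx.1, hy.1⟩
      refine integral_mul_subgradient hA (φ := fun x => U (x, y))
        (s := fun x => (m (x, y)).1.1)
        (Continuous.continuousOn (by fun_prop)) fun x hx x' hx' => ?_
      have := h.subgradient (hmem x hx) (hmem x' hx')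
      simp only [hUV _ (hmem x hx), hUV _ (hmem x' hx')]
      simpa using this
    rw [intervalIntegral.integral_congr hslice, intervalIntegral.integral_sub]
    · congr 1
      have := intervalIntegral.integral_comp_sub_left
        (fun σ => c * σ * U (c * σ, 1 - σ)) (a := 0) (b := 1) 1
      simp only [sub_sub_cancel, sub_self, sub_zero] at this
      rw [this, ← intervalIntegral.integral_const_mul]
      simp only [mul_assoc]
    · exact Continuous.intervalIntegrable (by fun_prop) _ _
    · refine Continuous.intervalIntegrable ?_ _ _
      exact intervalIntegral.continuous_parametric_intervalIntegral_of_continuous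
        (f := fun y x => U (x, y)) (by fun_prop) (by fun_prop)
  have e2 : ∫ v in triangle c, v.2 * (m v).1.2 =
      c * (∫ σ in (0 : ℝ)..1, (1 - σ) * U (c * σ, 1 - σ)) - ∫ v in triangle c, U v := by
    rw [setIntegral_triangle hc (h.integrableOn_value_snd hc),
      setIntegral_triangle hc hUi]
    have hslice : ∀ x ∈ uIcc (0 : ℝ) c, ∫ y in (0 : ℝ)..(1 - x / c), y * (m (x, y)).1.2 =
        (1 - x / c) * U (x, 1 - x / c) - ∫ y in (0 : ℝ)..(1 - x / c), U (x, y) := by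
      intro x hx
      rw [uIcc_of_le hc.le] at hx
      have hA : 0 ≤ 1 - x / c := by rw [sub_nonneg, div_le_one hc]; exact hx.2
      have hmem : ∀ y ∈ Icc 0 (1 - x / c), (x, y) ∈ triangle c := by
        intro y hy
        exact ⟨by simpa using by linarith [hy.2], hx.1, hy.1⟩
      refine integral_mul_subgradient hA (φ := fun y => U (x, y))
        (s := fun y => (m (x, y)).1.2)
        (Continuous.continuousOn (by fun_prop)) fun y hy y' hy' => ?_
      have := h.subgradient (hmem y hy) (hmem y' hy')
      simp only [hUV _ (hmem y hy), hUV _ (hmem y' hy')]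
      simpa using this
    rw [intervalIntegral.integral_congr hslice, intervalIntegral.integral_sub]
    · congr 1
      have := intervalIntegral.mul_integral_comp_mul_left
        (f := fun x => (1 - x / c) * U (x, 1 - x / c)) (a := 0) (b := 1) (c := c)
      simp only [mul_zero, mul_one, mul_div_cancel_left₀ _ hc.ne'] at this
      exact this.symm
    · exact Continuous.intervalIntegrable (by fun_prop) _ _
    · refine Continuous.intervalIntegrable ?_ _ _
      exact intervalIntegral.continuous_parametric_intervalIntegral_of_continuous
        (f := fun x y => U (x, y)) (by fun_prop) (by fun_prop)
  -- The boundary terms of the two integrations by parts carry weights `σ` and `1 - σ`, which add up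
  -- to the unweighted hypotenuse integral.
  have e3 : (∫ σ in (0 : ℝ)..1, σ * U (c * σ, 1 - σ)) +
      (∫ σ in (0 : ℝ)..1, (1 - σ) * U (c * σ, 1 - σ)) =
      ∫ σ in (0 : ℝ)..1, U (c * σ, 1 - σ) := by
    rw [← intervalIntegral.integral_add (Continuous.intervalIntegrable (by fun_prop) _ _)
      (Continuous.intervalIntegrable (by fun_prop) _ _)]
    congr 1; ext σ; ring
  rw [e0, e1, e2, ← e3]
  ring

end IsICIR

lemma uniformTriangle_eq {c : ℝ} (hc : 0 < c) :
    uniformTriangle c = ENNReal.ofReal (2 / c) • volume.restrict (triangle c) := by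
  rw [uniformTriangle, ProbabilityTheory.cond, volume_triangle hc,
    ← ENNReal.ofReal_inv_of_pos (by positivity), inv_div]

lemma revenue_uniformTriangle {c : ℝ} (hc : 0 < c) (m : BuyerType → Outcome) :
    revenue (uniformTriangle c) m = 2 / c * ∫ v in triangle c, (m v).2 := by
  rw [revenue, uniformTriangle_eq hc, integral_smul_measure,
    ENNReal.toReal_ofReal (by positivity), smul_eq_mul]

lemma IsICIR.integrable_payment {m : BuyerType → Outcome} {c : ℝ} (hc : 0 < c)
    (h : IsICIR (triangle c) m) : Integrable (fun v => (m v).2) (uniformTriangle c) := by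
  rw [uniformTriangle_eq hc]
  exact (h.integrableOn_payment hc).smul_measure ENNReal.ofReal_ne_top

/-! ### Pricing conditions and the areas of the selling regions. -/

/-- Conditions on the threshold `s` and the bundle price `P` under which selling the bundle at
price `P` to the types with `v₁ ≥ c s`, and `(1 / c, 1)` at price `2 / 3` to the others, is
optimal. -/
structure OptimalPricing (c s P : ℝ) : Prop where
  one_le : 1 ≤ c
  nonneg : 0 ≤ s
  le_third : s ≤ 1 / 3
  le_price : c / 3 ≤ P
  price_le : P ≤ 2 / 3 + (c - 1) * s
  -- Rearranged, `c r² / 2 - (P - c (1 - r))² / 2 ≤ c r / 3`: a corner triangle of height `r`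
  -- touching the axis `v₂ = 0`, minus its part below `v₁ + v₂ = P`, has area at most `c r / 3`. The
  -- field `balance` is equality at `r = 1 - s`.
  cut : ∀ r, 2 / 3 ≤ r → r ≤ 1 - s → c * (3 * r ^ 2 - 2 * r) ≤ 3 * (P - c * (1 - r)) ^ 2
  balance : 3 * (P - c * s) ^ 2 = c * (3 * (1 - s) ^ 2 - 2 * (1 - s))

/-- The types above the line `v₁ / c + v₂ = 2 / 3` to the left of `v₁ = c s`. -/
def leftRegion (c s : ℝ) : Set BuyerType :=
  {v | v.1 / c ∈ Ico 0 s ∧ 2 / 3 < v.1 / c + v.2 ∧ v.1 / c + v.2 ≤ 1}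

/-- The types with `v₁ ≥ a` and `v₂ ≥ b` above the line `v₁ + v₂ = P`. -/
def bundleRegion (a b c P : ℝ) : Set BuyerType :=
  cornerTriangle a b c 1 \ cornerTriangle a b 1 P

lemma mem_bundleRegion {a b c P : ℝ} {v : BuyerType} :
    v ∈ bundleRegion a b c P ↔ a ≤ v.1 ∧ b ≤ v.2 ∧ v.1 / c + v.2 ≤ 1 ∧ P < v.1 + v.2 := by
  simp only [bundleRegion, cornerTriangle, mem_sdiff, mem_ofPred_eq, div_one, not_and, not_le]
  exact ⟨fun h => ⟨h.1.1, h.1.2.1, h.1.2.2, h.2 h.1.1 h.1.2.1⟩,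
    fun h => ⟨⟨h.1, h.2.1, h.2.2.1⟩, fun _ _ => h.2.2.2⟩⟩

lemma measurableSet_bundleRegion (a b c P : ℝ) : MeasurableSet (bundleRegion a b c P) :=
  (measurableSet_cornerTriangle a b c 1).diff (measurableSet_cornerTriangle a b 1 P)

lemma measurableSet_leftRegion (c s : ℝ) : MeasurableSet (leftRegion c s) :=
  ((measurable_fst.div_const c) measurableSet_Ico).inter
    ((measurableSet_lt measurable_const (measurable_div_add c)).inter
      (measurableSet_le (measurable_div_add c) measurable_const))

/-- A difference of two right triangles with the same corner; `1 ≤ c` and `q ≤ r` put the removed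
one inside the other. -/
lemma volume_bundleRegion {a b c P q r : ℝ} (hc : 1 ≤ c) (hq : 0 ≤ q) (hqr : q ≤ r)
    (hq' : P - a - b = q) (hr' : 1 - a / c - b = r) :
    volume (bundleRegion a b c P) = ENNReal.ofReal (c * r ^ 2 / 2 - q ^ 2 / 2) := by
  have hsub : cornerTriangle a b 1 P ⊆ cornerTriangle a b c 1 := by
    rintro v ⟨h1, h2, h3⟩
    refine ⟨h1, h2, ?_⟩
    have h4 : (v.1 - a) / c ≤ v.1 - a := div_le_self (by linarith) hc
    have h5 : v.1 / c = (v.1 - a) / c + a / c := by ring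
    rw [div_one] at h3
    linarith
  have hq2 := volume_cornerTriangle (a := a) (b := b) (d := P) one_pos hq (by simpa using hq')
  rw [bundleRegion, measure_sdiff hsub (measurableSet_cornerTriangle a b 1 P).nullMeasurableSet
    (by simp [hq2]), hq2, volume_cornerTriangle (by linarith) (hq.trans hqr) hr',
    ← ENNReal.ofReal_sub _ (by positivity), one_mul]

namespace OptimalPricing

variable {c s P : ℝ}

lemma pos (h : OptimalPricing c s P) : 0 < c := by linarith [h.one_le]

lemma volume_leftRegion (h : OptimalPricing c s P) :
    volume (leftRegion c s) = ENNReal.ofReal (c / 3 * s) := by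
  rw [leftRegion, volume_strip h.pos measurableSet_Ico, Real.volume_Ico, sub_zero,
    ← ENNReal.ofReal_mul (by linarith [h.pos])]

lemma threshold_le_price (h : OptimalPricing c s P) : c * s ≤ P := by
  nlinarith [h.le_third, h.le_price, h.pos]

lemma volume_bundleRegion_self (h : OptimalPricing c s P) :
    volume (bundleRegion (c * s) 0 c P) = ENNReal.ofReal (c / 3 * (1 - s)) := by
  rw [volume_bundleRegion h.one_le (q := P - c * s) (r := 1 - s)
    (by linarith [h.threshold_le_price]) (by linarith [h.price_le, h.nonneg]) (by ring)
    (by rw [mul_div_cancel_left₀ _ h.pos.ne']; ring)]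
  congr 1
  linarith [h.balance]

lemma volume_bundleRegion_le (h : OptimalPricing c s P) {x y : ℝ} (hx : s ≤ x) (hxy : x ≤ y)
    (hy : y ≤ 1) :
    volume (bundleRegion (c * x) (1 - y) c P) ≤ ENNReal.ofReal (c / 3 * (y - x)) := by
  have hc := h.pos
  have hc1 := h.one_le
  have hr' : 1 - c * x / c - (1 - y) = y - x := by rw [mul_div_cancel_left₀ _ h.pos.ne']; ring
  -- For `r = y - x ≤ 2 / 3` the whole triangle, of area `c r² / 2`, is already small enough; beyond
  -- that the removed corner is needed.
  rcases le_total (y - x) (2 / 3) with hr | hr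
  · refine (measure_mono sdiff_subset).trans ?_
    rw [volume_cornerTriangle hc (by linarith) hr']
    refine ENNReal.ofReal_le_ofReal ?_
    have : c * (y - x) * (y - x) ≤ c * (y - x) * (2 / 3) :=
      mul_le_mul_of_nonneg_left hr (mul_nonneg hc.le (by linarith))
    linarith
  · have hx3 : x ≤ 1 / 3 := by linarith
    have hq0 : 0 ≤ P - c * (1 - (y - x)) := by nlinarith [h.le_price]
    -- For fixed `y - x` the removed corner is smallest when `y = 1`, because `1 ≤ c`; this is the
    -- case governed by `cut`.
    have hq : P - c * (1 - (y - x)) ≤ P - c * x - (1 - y) := by nlinarith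
    have hs : (c - 1) * s ≤ (c - 1) * x := mul_le_mul_of_nonneg_left hx (by linarith)
    rw [volume_bundleRegion h.one_le (hq0.trans hq) (by linarith [h.price_le]) rfl hr']
    refine ENNReal.ofReal_le_ofReal ?_
    have h1 := h.cut (y - x) hr (by linarith)
    have h2 : (P - c * (1 - (y - x))) ^ 2 ≤ (P - c * x - (1 - y)) ^ 2 :=
      pow_le_pow_left₀ hq0 hq 2
    linarith

lemma disjoint_regions (h : OptimalPricing c s P) :
    Disjoint (leftRegion c s) (bundleRegion (c * s) 0 c P) := by
  rw [Set.disjoint_left]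
  intro v hv hw
  have h1 := hv.1.2
  rw [div_lt_iff₀ h.pos, mul_comm] at h1
  linarith [(mem_bundleRegion.1 hw).1]

lemma leftRegion_subset (h : OptimalPricing c s P) : leftRegion c s ⊆ triangle c := by
  rintro v ⟨⟨h1, h2⟩, h3, h4⟩
  refine ⟨h4, ?_, by linarith [h.le_third]⟩
  rwa [le_div_iff₀ h.pos, zero_mul] at h1

lemma bundleRegion_subset (h : OptimalPricing c s P) :
    bundleRegion (c * s) 0 c P ⊆ triangle c := by
  intro v hv
  have := mem_bundleRegion.1 hv
  exact ⟨this.2.2.1, (mul_nonneg h.pos.le h.nonneg).trans this.1, this.2.1⟩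

lemma hypotenuse_mem_bundleRegion (h : OptimalPricing c s P) {σ : ℝ} (hσ : σ ∈ Icc s 1) :
    (c * σ, 1 - σ) ∈ bundleRegion (c * s) 0 c P := by
  rw [mem_bundleRegion]
  refine ⟨mul_le_mul_of_nonneg_left hσ.1 h.pos.le, by simpa using hσ.2, ?_, ?_⟩
  · simp [mul_div_cancel_left₀ _ h.pos.ne']
  · have : (c - 1) * s ≤ (c - 1) * σ := mul_le_mul_of_nonneg_left hσ.1 (by linarith [h.one_le])
    simp only
    linarith [h.price_le]

/-! ### Comparison of the selling region with the hypotenuse. -/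

/-- The sublevel set of `g` in the region where something is sold is at most as large, suitably
scaled, as that of its restriction to the hypotenuse. -/
lemma volume_sublevel_le (h : OptimalPricing c s P) {g : BuyerType → ℝ} (hg : Continuous g)
    (hleft : ∀ v ∈ leftRegion c s, g (v.1, 1 - v.1 / c) ≤ g v)
    (hbundle : ∀ v ∈ bundleRegion (c * s) 0 c P,
      g (v.1, 1 - v.1 / c) ≤ g v ∧ g (c * (1 - v.2), v.2) ≤ g v)
    (k : ℝ) (hconn : OrdConnected {σ | σ ∈ Icc s 1 ∧ g (c * σ, 1 - σ) < k}) :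
    volume ((leftRegion c s ∪ bundleRegion (c * s) 0 c P) ∩ {v | g v < k}) ≤
      ENNReal.ofReal (c / 3) * volume (Icc 0 1 ∩ {σ | g (c * σ, 1 - σ) < k}) := by
  have hc := h.pos
  have hmk : MeasurableSet {σ | g (c * σ, 1 - σ) < k} :=
    measurableSet_lt (Continuous.measurable (by fun_prop)) measurable_const
  set S := Ico 0 s ∩ {σ | g (c * σ, 1 - σ) < k} with hS
  set I := {σ | σ ∈ Icc s 1 ∧ g (c * σ, 1 - σ) < k} with hI
  have hIm : MeasurableSet I := measurableSet_Icc.inter hmk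
  have hSI : S ∪ I ⊆ Icc 0 1 ∩ {σ | g (c * σ, 1 - σ) < k} := by
    rintro σ (hσ | hσ)
    · exact ⟨⟨hσ.1.1, by linarith [hσ.1.2, h.le_third]⟩, hσ.2⟩
    · exact ⟨⟨h.nonneg.trans hσ.1.1, hσ.1.2⟩, hσ.2⟩
  have hdisj : Disjoint S I := by
    rw [Set.disjoint_left]
    intro σ h1 h2
    exact absurd h1.1.2 (not_lt.2 h2.1.1)
  have hL : volume (leftRegion c s ∩ {v | g v < k}) ≤ ENNReal.ofReal (c / 3) * volume S := by
    rw [← volume_strip hc (measurableSet_Ico.inter hmk)]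
    refine measure_mono fun v hv => ⟨⟨hv.1.1, ?_⟩, hv.1.2⟩
    simp only [mem_ofPred_eq, mul_div_cancel₀ _ hc.ne']
    exact (hleft v hv.1).trans_lt hv.2
  have hW : volume (bundleRegion (c * s) 0 c P ∩ {v | g v < k}) ≤
      ENNReal.ofReal (c / 3) * volume I := by
    have hmemI : ∀ v ∈ bundleRegion (c * s) 0 c P ∩ {v | g v < k}, v.1 / c ∈ I ∧ 1 - v.2 ∈ I := by
      rintro v ⟨hv, hvk⟩
      have hb := mem_bundleRegion.1 hv
      have hs : s ≤ v.1 / c := by rw [le_div_iff₀ hc, mul_comm]; exact hb.1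
      refine ⟨⟨⟨hs, by linarith [hb.2.1, hb.2.2.1]⟩, ?_⟩,
        ⟨⟨by linarith [hb.2.2.1], by linarith [hb.2.1]⟩, ?_⟩⟩
      · rw [mul_div_cancel₀ _ hc.ne']
        exact (hbundle v hv).1.trans_lt hvk
      · rw [sub_sub_cancel]
        exact (hbundle v hv).2.trans_lt hvk
    rcases I.eq_empty_or_nonempty with hemp | hne
    · have : bundleRegion (c * s) 0 c P ∩ {v | g v < k} = ∅ := by
        refine eq_empty_of_forall_notMem fun v hv => ?_
        have := (hmemI v hv).1
        rw [hemp] at this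
        exact this
      rw [this, measure_empty]
      exact zero_le
    · have hbb : BddBelow I := ⟨s, fun σ hσ => hσ.1.1⟩
      have hba : BddAbove I := ⟨1, fun σ hσ => hσ.1.2⟩
      -- Both the vertical and the horizontal projection to the hypotenuse land in `I`, which bounds
      -- `v.1` and `v.2` from below.
      have hsub : bundleRegion (c * s) 0 c P ∩ {v | g v < k} ⊆
          bundleRegion (c * sInf I) (1 - sSup I) c P := by
        intro v hv
        have hb := mem_bundleRegion.1 hv.1
        have hI' := hmemI v hv
        refine mem_bundleRegion.2 ⟨?_, ?_, hb.2.2⟩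
        · have := csInf_le hbb hI'.1
          rwa [le_div_iff₀ hc, mul_comm] at this
        · have := le_csSup hba hI'.2
          linarith
      refine (measure_mono hsub).trans ((h.volume_bundleRegion_le
        (le_csInf hne fun σ hσ => hσ.1.1) (csInf_le_csSup hne hbb hba)
        (csSup_le hne fun σ hσ => hσ.1.2)).trans ?_)
      -- `I` need not contain its endpoints, but order-connectedness gives the open interval between
      -- them.
      rw [ENNReal.ofReal_mul (by linarith), ← Real.volume_Ioo]
      gcongr
      intro σ hσ
      obtain ⟨x, hx, hxσ⟩ := exists_lt_of_csInf_lt hne hσ.1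
      obtain ⟨y, hy, hyσ⟩ := exists_lt_of_lt_csSup hne hσ.2
      exact hconn.out hx hy ⟨hxσ.le, hyσ.le⟩
  calc _ ≤ volume (leftRegion c s ∩ {v | g v < k}) +
        volume (bundleRegion (c * s) 0 c P ∩ {v | g v < k}) := by
        rw [union_inter_distrib_right]; exact measure_union_le _ _
    _ ≤ ENNReal.ofReal (c / 3) * volume S + ENNReal.ofReal (c / 3) * volume I := add_le_add hL hW
    _ = ENNReal.ofReal (c / 3) * volume (S ∪ I) := by rw [measure_union hdisj hIm, mul_add]
    _ ≤ _ := by gcongr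

lemma hypotenuse_integral_le (h : OptimalPricing c s P) {g : BuyerType → ℝ} (hg : Continuous g)
    {C : ℝ} (hC : ∀ v ∈ triangle c, g v ≤ C)
    (hleft : ∀ v ∈ leftRegion c s, g (v.1, 1 - v.1 / c) ≤ g v)
    (hbundle : ∀ v ∈ bundleRegion (c * s) 0 c P,
      g (v.1, 1 - v.1 / c) ≤ g v ∧ g (c * (1 - v.2), v.2) ≤ g v)
    (hconn : ∀ k, OrdConnected {σ | σ ∈ Icc s 1 ∧ g (c * σ, 1 - σ) < k}) :
    c * ∫ σ in (0 : ℝ)..1, g (c * σ, 1 - σ) ≤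
      3 * ∫ v in leftRegion c s ∪ bundleRegion (c * s) 0 c P, g v := by
  have hc := h.pos
  set R := leftRegion c s ∪ bundleRegion (c * s) 0 c P with hR
  have hRT : R ⊆ triangle c := union_subset h.leftRegion_subset h.bundleRegion_subset
  have hRm : MeasurableSet R :=
    (measurableSet_leftRegion c s).union (measurableSet_bundleRegion _ _ _ _)
  have hs1 : s ≤ 1 := by linarith [h.le_third]
  -- Equal total masses let the constant `C`, added only to make the integrands nonnegative, cancel
  -- at the end.
  have hRvol : volume R = ENNReal.ofReal (c / 3) := by
    rw [hR, measure_union h.disjoint_regions (measurableSet_bundleRegion _ _ _ _),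
      h.volume_leftRegion, h.volume_bundleRegion_self,
      ← ENNReal.ofReal_add (mul_nonneg (by linarith) h.nonneg)
        (mul_nonneg (by linarith) (by linarith))]
    congr 1; ring
  have hgi : IntegrableOn g R := (integrableOn_triangle_of_continuous hc hg).mono_set hRT
  have hCi : IntegrableOn (fun _ => C) R := integrableOn_const (by simp [hRvol])
  have hhi : IntegrableOn (fun σ => C - g (c * σ, 1 - σ)) (Icc 0 1) :=
    (Continuous.continuousOn (by fun_prop)).integrableOn_Icc
  have key := integral_le_of_superlevel (μ := volume.restrict R)
    (ν := ENNReal.ofReal (c / 3) • volume.restrict (Icc (0 : ℝ) 1))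
    (f := fun v => C - g v) (g := fun σ => C - g (c * σ, 1 - σ))
    (hCi.sub hgi) (hhi.smul_measure ENNReal.ofReal_ne_top)
    ((ae_restrict_iff' hRm).2 (.of_forall fun v hv => sub_nonneg.2 (hC v (hRT hv))))
    (Measure.ae_smul_measure ((ae_restrict_iff' measurableSet_Icc).2 (.of_forall fun σ hσ =>
      sub_nonneg.2 (hC _ (hypotenuse_mem_triangle hc hσ)))) _)
    (fun t => by
      have e1 : {v : BuyerType | t < C - g v} = {v | g v < C - t} := by
        ext v; simp only [mem_ofPred_eq]; exact lt_sub_comm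
      have e2 : {σ : ℝ | t < C - g (c * σ, 1 - σ)} = {σ | g (c * σ, 1 - σ) < C - t} := by
        ext v; simp only [mem_ofPred_eq]; exact lt_sub_comm
      have m1 : MeasurableSet {v : BuyerType | g v < C - t} :=
        measurableSet_lt hg.measurable measurable_const
      have m2 : MeasurableSet {σ : ℝ | g (c * σ, 1 - σ) < C - t} :=
        measurableSet_lt (Continuous.measurable (by fun_prop)) measurable_const
      rw [e1, e2, Measure.smul_apply, Measure.restrict_apply m1, Measure.restrict_apply m2,
        smul_eq_mul, inter_comm, inter_comm _ (Icc (0 : ℝ) 1)]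
      exact h.volume_sublevel_le hg hleft hbundle (C - t) (hconn _))
  rw [integral_smul_measure, ENNReal.toReal_ofReal (by linarith), integral_sub hCi hgi,
    setIntegral_const, Measure.real, hRvol, ENNReal.toReal_ofReal (by linarith),
    integral_Icc_eq_integral_Ioc, ← intervalIntegral.integral_of_le zero_le_one,
    intervalIntegral.integral_sub (by simp) (Continuous.intervalIntegrable (by fun_prop) _ _)]
    at key
  simp only [intervalIntegral.integral_const, smul_eq_mul, sub_zero, one_mul] at key
  linarith

/-- A mechanism whose indirect utility is that of the menu with `(1 / c, 1)` at price `2 / 3` and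
the bundle at price `P` earns at least as much as any other. -/
theorem revenue_le (h : OptimalPricing c s P) {m m' : BuyerType → Outcome}
    (hm : IsICIR (triangle c) m) (hm' : IsICIR (triangle c) m')
    (hleft : ∀ v ∈ leftRegion c s, utility v (m v) = v.1 / c + v.2 - 2 / 3)
    (hbundle : ∀ v ∈ bundleRegion (c * s) 0 c P, utility v (m v) = v.1 + v.2 - P)
    (hzero : ∀ v ∈ triangle c, v ∉ leftRegion c s → v ∉ bundleRegion (c * s) 0 c P →
      utility v (m v) = 0) :
    revenue (uniformTriangle c) m' ≤ revenue (uniformTriangle c) m := by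
  have hc := h.pos
  obtain ⟨U, hU, hUm⟩ := hm.exists_lipschitz
  obtain ⟨U', hU', hUm'⟩ := hm'.exists_lipschitz
  have hUc := hU.continuous
  have hUc' := hU'.continuous
  rw [revenue_uniformTriangle hc, revenue_uniformTriangle hc,
    hm.setIntegral_payment hc hUc hUm, hm'.setIntegral_payment hc hUc' hUm']
  refine mul_le_mul_of_nonneg_left ?_ (by positivity)
  set R := leftRegion c s ∪ bundleRegion (c * s) 0 c P with hR
  have hRT : R ⊆ triangle c := union_subset h.leftRegion_subset h.bundleRegion_subset
  have hRm : MeasurableSet R :=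
    (measurableSet_leftRegion c s).union (measurableSet_bundleRegion _ _ _ _)
  let g : BuyerType → ℝ := fun v => U' v - U v
  have hg : Continuous g := hUc'.sub hUc
  have hgT := integrableOn_triangle_of_continuous hc hg
  have h00 : ((0, 0) : BuyerType) ∈ triangle c := ⟨by simp, le_rfl, le_rfl⟩
  -- Allocations are at most `1`, so `U'` never grows faster than the bundle utility; this makes `g`
  -- nonincreasing wherever `U` has slope `1`.
  have step : ∀ v ∈ triangle c, ∀ w ∈ triangle c, v.1 ≤ w.1 → v.2 ≤ w.2 →
      U' w ≤ U' v + (w.1 - v.1) + (w.2 - v.2) := by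
    intro v hv w hw h1 h2
    have hs := hm'.subgradient hw hv
    rw [← hUm' v hv, ← hUm' w hw] at hs
    have hx := hm'.feasible₁ w hw
    have hy := hm'.feasible₂ w hw
    nlinarith [mul_nonneg (sub_nonneg.2 h1) (sub_nonneg.2 hx.2),
      mul_nonneg (sub_nonneg.2 h2) (sub_nonneg.2 hy.2)]
  have hgC : ∀ v ∈ triangle c, g v ≤ U' (0, 0) + c + 1 := by
    intro v hv
    have h1 := step (0, 0) h00 v hv hv.2.1 hv.2.2
    have h2 : 0 ≤ U v := by rw [hUm v hv]; exact hm.ir v hv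
    have h3 := fst_le_of_mem_triangle hc hv
    have h4 := snd_le_of_mem_triangle hc hv
    simp only [sub_zero] at h1
    simp only [g]
    linarith
  have hgL : ∀ v ∈ leftRegion c s, g (v.1, 1 - v.1 / c) ≤ g v := by
    intro v hv
    have hw : (v.1, 1 - v.1 / c) ∈ leftRegion c s := ⟨hv.1, by simp; norm_num, by simp⟩
    have h1 := step v (h.leftRegion_subset hv) _ (h.leftRegion_subset hw) le_rfl
      (by simp only; linarith [hv.2.2])
    simp only [g]
    rw [hUm _ (h.leftRegion_subset hv), hUm _ (h.leftRegion_subset hw), hleft _ hv, hleft _ hw]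
    simp only at h1 ⊢
    linarith
  have hdrop : ∀ v ∈ bundleRegion (c * s) 0 c P, ∀ w ∈ bundleRegion (c * s) 0 c P,
      v.1 ≤ w.1 → v.2 ≤ w.2 → g w ≤ g v := by
    intro v hv w hw h1 h2
    have h3 := step v (h.bundleRegion_subset hv) w (h.bundleRegion_subset hw) h1 h2
    simp only [g]
    rw [hUm _ (h.bundleRegion_subset hv), hUm _ (h.bundleRegion_subset hw), hbundle _ hv,
      hbundle _ hw]
    linarith
  have hgW : ∀ v ∈ bundleRegion (c * s) 0 c P,
      g (v.1, 1 - v.1 / c) ≤ g v ∧ g (c * (1 - v.2), v.2) ≤ g v := by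
    intro v hv
    obtain ⟨h1, h2, h3, h4⟩ := mem_bundleRegion.1 hv
    have hs : s ≤ v.1 / c := by rw [le_div_iff₀ hc, mul_comm]; exact h1
    have hw1 := h.hypotenuse_mem_bundleRegion (σ := v.1 / c) ⟨hs, by linarith⟩
    have hw2 := h.hypotenuse_mem_bundleRegion (σ := 1 - v.2) ⟨by linarith, by linarith⟩
    rw [mul_div_cancel₀ _ hc.ne'] at hw1
    rw [sub_sub_cancel] at hw2
    refine ⟨hdrop v hv _ hw1 le_rfl (by simp only; linarith), hdrop v hv _ hw2 ?_ le_rfl⟩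
    rw [mul_comm, ← div_le_iff₀ hc]
    linarith
  have hconn : ∀ k, OrdConnected {σ | σ ∈ Icc s 1 ∧ g (c * σ, 1 - σ) < k} := by
    intro k
    have hval : ∀ σ ∈ Icc s 1, g (c * σ, 1 - σ) = U' (c * σ, 1 - σ) - (c * σ + (1 - σ) - P) := by
      intro σ hσ
      have hmem := h.hypotenuse_mem_bundleRegion hσ
      simp only [g]
      rw [hUm _ (h.bundleRegion_subset hmem), hbundle _ hmem]
    refine ⟨fun x hx y hy z hz => ?_⟩
    have hzI : z ∈ Icc s 1 := ⟨hx.1.1.trans hz.1, hz.2.trans hy.1.2⟩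
    refine ⟨hzI, ?_⟩
    have mem : ∀ σ ∈ Icc s 1, (c * σ, 1 - σ) ∈ triangle c := fun σ hσ =>
      h.bundleRegion_subset (h.hypotenuse_mem_bundleRegion hσ)
    have sx := hm'.subgradient (mem z hzI) (mem x hx.1)
    have sy := hm'.subgradient (mem z hzI) (mem y hy.1)
    rw [← hUm' _ (mem z hzI), ← hUm' _ (mem x hx.1)] at sx
    rw [← hUm' _ (mem z hzI), ← hUm' _ (mem y hy.1)] at sy
    have kx := hx.2
    have ky := hy.2
    -- Along the hypotenuse `U` is affine, so the subgradient of `U'` at `z` supports `g` from below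
    -- with slope `c * p - q - (c - 1)`. Its sign decides which endpoint has a value of `g` at least
    -- that at `z`.
    rw [hval x hx.1] at kx
    rw [hval y hy.1] at ky
    rw [hval z hzI]
    simp only at sx sy
    set p := (m' (c * z, 1 - z)).1.1
    set q := (m' (c * z, 1 - z)).1.2
    rcases le_total 0 (c * p - q - (c - 1)) with hD | hD
    · have := mul_nonneg hD (sub_nonneg.2 hz.2)
      linarith
    · have := mul_nonneg (neg_nonneg.2 hD) (sub_nonneg.2 hz.1)
      linarith
  have main := h.hypotenuse_integral_le hg hgC hgL hgW hconn
  have hsplit : ∫ v in R, g v ≤ ∫ v in triangle c, g v := by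
    rw [← integral_inter_add_sdiff hRm hgT, inter_eq_right.2 hRT]
    refine le_add_of_nonneg_right (setIntegral_nonneg ((measurableSet_triangle c).diff hRm) ?_)
    rintro v ⟨hv, hvR⟩
    have h1 : U v = 0 := by
      rw [hUm v hv]
      exact hzero v hv (fun h => hvR (.inl h)) (fun h => hvR (.inr h))
    have h2 : 0 ≤ U' v := by rw [hUm' v hv]; exact hm'.ir v hv
    simp only [g]
    linarith
  simp only [g] at main hsplit
  rw [integral_sub (integrableOn_triangle_of_continuous hc hUc')
    (integrableOn_triangle_of_continuous hc hUc)] at hsplit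
  rw [intervalIntegral.integral_sub (Continuous.intervalIntegrable (by fun_prop) _ _)
    (Continuous.intervalIntegrable (by fun_prop) _ _)] at main
  linarith

end OptimalPricing

/-! ### Verification of the two price choices. -/

lemma exists_implements (V : Set BuyerType) {M : Set Outcome} (hfin : M.Finite)
    (hne : M.Nonempty) : ∃ m, Implements V M m := by
  choose m hm using fun v : BuyerType => Set.exists_max_image M (utility v) hfin hne
  exact ⟨m, fun v _ => hm v⟩

lemma Implements.isICIR {V : Set BuyerType} {M : Set Outcome} {m : BuyerType → Outcome}
    (h : Implements V M m) (h0 : ((0, 0), 0) ∈ M)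
    (hM : ∀ o ∈ M, o.1.1 ∈ Icc (0 : ℝ) 1 ∧ o.1.2 ∈ Icc (0 : ℝ) 1) : IsICIR V m where
  feasible₁ v hv := (hM _ (h v hv).1).1
  feasible₂ v hv := (hM _ (h v hv).1).2
  ic v hv w hw := (h v hv).2 _ (h w hw).1
  ir v hv := by simpa [utility] using (h v hv).2 _ h0

lemma optimalPricing_bundle {c : ℝ} (hc : 1 ≤ c) (hc' : c ≤ 4 / 3) :
    OptimalPricing c 0 (Real.sqrt (c / 3)) := by
  have hsq : Real.sqrt (c / 3) ^ 2 = c / 3 := Real.sq_sqrt (by linarith)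
  have h0 : 0 ≤ Real.sqrt (c / 3) := Real.sqrt_nonneg _
  have hle : Real.sqrt (c / 3) ≤ 2 / 3 := by
    rw [Real.sqrt_le_iff]; constructor <;> linarith
  set P := Real.sqrt (c / 3)
  refine ⟨hc, le_rfl, by norm_num, ?_, by linarith, ?_, ?_⟩
  · nlinarith
  · intro r h1 h2
    -- The slack in `cut` is exactly this term plus three times `h4`; its sign is where `P ≤ 2 / 3`,
    -- that is `c ≤ 4 / 3`, enters.
    have h3 : 0 ≤ c * (1 - r) * (4 - 6 * P) :=
      mul_nonneg (mul_nonneg (by linarith) (by linarith)) (by linarith)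
    have h4 : 0 ≤ c * (c - 1) * (1 - r) ^ 2 :=
      mul_nonneg (mul_nonneg (by linarith) (by linarith)) (sq_nonneg _)
    nlinarith
  · simp only [mul_zero, sub_zero, hsq]; ring

/-- The value of `v₁ / c` at which the two nontrivial menu items are equally good. -/
def menuThreshold (c : ℝ) : ℝ := (2 - Real.sqrt (c * (c - 1)) / (c - 1)) / 3

lemma price_eq_menuThreshold {c : ℝ} (hc : 1 < c) :
    2 / 3 * c - 1 / 3 * Real.sqrt (c * (c - 1)) = 2 / 3 + (c - 1) * menuThreshold c := by
  have : c - 1 ≠ 0 := by linarith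
  rw [menuThreshold]
  field_simp
  ring

lemma optimalPricing_menu {c : ℝ} (hc : 4 / 3 < c) :
    OptimalPricing c (menuThreshold c) (2 / 3 * c - 1 / 3 * Real.sqrt (c * (c - 1))) := by
  have hpos : 0 < c - 1 := by linarith
  have hsq : Real.sqrt (c * (c - 1)) ^ 2 = c * (c - 1) := Real.sq_sqrt (by nlinarith)
  have h0 : 0 ≤ Real.sqrt (c * (c - 1)) := Real.sqrt_nonneg _
  have hP := price_eq_menuThreshold (by linarith : 1 < c)
  have hs : (c - 1) * (2 - 3 * menuThreshold c) = Real.sqrt (c * (c - 1)) := by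
    rw [menuThreshold]; field_simp; ring
  -- `hlow` yields `s ≤ 1 / 3`, `hup` (which needs `4 / 3 ≤ c`) yields `0 ≤ s`, and `hup'` yields `c
  -- / 3 ≤ P`.
  have hlow : c - 1 ≤ Real.sqrt (c * (c - 1)) := Real.le_sqrt_of_sq_le (by nlinarith)
  have hup : Real.sqrt (c * (c - 1)) ≤ 2 * (c - 1) := by
    rw [Real.sqrt_le_iff]; constructor <;> nlinarith
  have hup' : Real.sqrt (c * (c - 1)) ≤ c := by
    rw [Real.sqrt_le_iff]; constructor <;> nlinarith
  rw [← hs] at hsq hlow hup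
  have hsq' : (c - 1) * (2 - 3 * menuThreshold c) ^ 2 = c := by
    have : (c - 1) * ((c - 1) * (2 - 3 * menuThreshold c) ^ 2 - c) = 0 := by linarith
    rcases mul_eq_zero.1 this with h | h <;> linarith
  have hs0 : 0 ≤ menuThreshold c := by nlinarith
  have hs1 : menuThreshold c ≤ 1 / 3 := by nlinarith
  -- The slack in `cut` is a nonnegative multiple of a square with double root `r = 1 - s`, so `cut`
  -- and `balance` hold together by tangency.
  have key : ∀ r, 3 * (2 / 3 * c - 1 / 3 * Real.sqrt (c * (c - 1)) - c * (1 - r)) ^ 2 -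
      c * (3 * r ^ 2 - 2 * r) = 3 * c * (c - 1) * (1 - r - menuThreshold c) ^ 2 := by
    intro r
    rw [hP]
    set s := menuThreshold c
    linear_combination (1 / 3 * (c - 1) - 1 / 3 * c) * hsq'
  refine ⟨by linarith, hs0, hs1, by linarith, hP.le, ?_, ?_⟩
  · intro r _ _
    have : 0 ≤ 3 * c * (c - 1) * (1 - r - menuThreshold c) ^ 2 :=
      mul_nonneg (mul_nonneg (by linarith) hpos.le) (sq_nonneg _)
    linarith [key r]
  · have := key (1 - menuThreshold c)
    simp only [sub_sub_cancel, sub_self] at this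
    linarith

lemma isOptimalMenu_bundle {c : ℝ} (hc : 1 ≤ c) (hc' : c ≤ 4 / 3) :
    IsOptimalMenu (triangle c) (uniformTriangle c)
      {((0, 0), 0), ((1, 1), Real.sqrt (c / 3))} := by
  have hopt := optimalPricing_bundle hc hc'
  refine ⟨exists_implements _ (by simp) (by simp), fun m hm => ?_⟩
  have hIC : IsICIR (triangle c) m := hm.isICIR (by simp) (by simp)
  refine ⟨hIC, fun m' hm' => hopt.revenue_le hIC hm' ?_ ?_ ?_⟩
  · intro v hv
    -- With threshold `0` the left region is empty.
    exact absurd (hv.1.1.trans_lt hv.1.2) (lt_irrefl 0)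
  · intro v hv
    obtain ⟨h1, h2⟩ := hm v (hopt.bundleRegion_subset hv)
    have h3 := (mem_bundleRegion.1 hv).2.2.2
    have h4 := h2 ((0, 0), 0) (by simp)
    have h5 := h2 ((1, 1), Real.sqrt (c / 3)) (by simp)
    simp only [utility] at h4 h5 ⊢
    rcases h1 with h | h
    · rw [h] at h4 h5 ⊢; linarith
    · rw [mem_singleton_iff.1 h] at h4 h5 ⊢; linarith
  · intro v hv _ hb
    obtain ⟨h1, h2⟩ := hm v hv
    have h3 : v.1 + v.2 ≤ Real.sqrt (c / 3) := by
      by_contra! h3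
      exact hb (mem_bundleRegion.2 ⟨by simpa using hv.2.1, hv.2.2, hv.1, h3⟩)
    have h4 := h2 ((0, 0), 0) (by simp)
    have h5 := h2 ((1, 1), Real.sqrt (c / 3)) (by simp)
    simp only [utility] at h4 h5 ⊢
    rcases h1 with h | h
    · rw [h] at h4 h5 ⊢; linarith
    · rw [mem_singleton_iff.1 h] at h4 h5 ⊢; linarith

/-! ### The three-item menu and its revenue. -/

section Menu

variable {c : ℝ} {m : BuyerType → Outcome}

lemma utility_cases_of_implements_menu {P : ℝ}
    (hm : Implements (triangle c) {((0, 0), 0), ((1 / c, 1), 2 / 3), ((1, 1), P)} m)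
    {v : BuyerType} (hv : v ∈ triangle c) :
    (utility v (m v) = 0 ∧ (m v).2 = 0 ∨
      utility v (m v) = v.1 / c + v.2 - 2 / 3 ∧ (m v).2 = 2 / 3 ∨
      utility v (m v) = v.1 + v.2 - P ∧ (m v).2 = P) ∧
    0 ≤ utility v (m v) ∧ v.1 / c + v.2 - 2 / 3 ≤ utility v (m v) ∧
      v.1 + v.2 - P ≤ utility v (m v) := by
  obtain ⟨h1, h2⟩ := hm v hv
  refine ⟨?_, ?_, ?_, ?_⟩
  · rcases h1 with h | h | h
    · left; simp [h, utility]
    · right; left; simp [h, utility, div_eq_mul_inv]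
    · right; right; rw [mem_singleton_iff.1 h]; simp [utility]
  · simpa [utility] using h2 ((0, 0), 0) (by simp)
  · simpa [utility, div_eq_mul_inv] using h2 ((1 / c, 1), 2 / 3) (by simp)
  · simpa [utility] using h2 ((1, 1), P) (by simp)

/-- The gain from `(1 / c, 1)` to the bundle, for a type `v`. -/
lemma bundle_sub_eq (hc : 4 / 3 < c) (v : BuyerType) :
    (v.1 + v.2 - (2 / 3 * c - 1 / 3 * Real.sqrt (c * (c - 1)))) - (v.1 / c + v.2 - 2 / 3) =
      (c - 1) * (v.1 / c - menuThreshold c) := by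
  rw [price_eq_menuThreshold (by linarith)]
  have : c ≠ 0 := by linarith
  field_simp
  ring

lemma bundle_le_iff (hc : 4 / 3 < c) (v : BuyerType) :
    v.1 + v.2 - (2 / 3 * c - 1 / 3 * Real.sqrt (c * (c - 1))) ≤ v.1 / c + v.2 - 2 / 3 ↔
      v.1 / c ≤ menuThreshold c := by
  rw [← sub_nonpos, bundle_sub_eq hc, ← sub_nonpos (a := v.1 / c),
    mul_nonpos_iff_pos_imp_nonpos]
  have : 0 < c - 1 := by linarith
  exact ⟨fun h => h.1 this, fun h => ⟨fun _ => h, fun _ => this.le⟩⟩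

lemma le_bundle_iff (hc : 4 / 3 < c) (v : BuyerType) :
    v.1 / c + v.2 - 2 / 3 ≤ v.1 + v.2 - (2 / 3 * c - 1 / 3 * Real.sqrt (c * (c - 1))) ↔
      menuThreshold c ≤ v.1 / c := by
  rw [← sub_nonneg, bundle_sub_eq hc, ← sub_nonneg (a := v.1 / c)]
  exact mul_nonneg_iff_of_pos_left (by linarith)

lemma mem_leftRegion_of_mem_triangle (hc : 0 < c) {s : ℝ} {v : BuyerType}
    (hv : v ∈ triangle c) : v ∈ leftRegion c s ↔ v.1 / c < s ∧ 2 / 3 < v.1 / c + v.2 :=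
  ⟨fun h => ⟨h.1.2, h.2.1⟩, fun h => ⟨⟨div_nonneg hv.2.1 hc.le, h.1⟩, h.2, hv.1⟩⟩

lemma mem_bundleRegion_of_mem_triangle (hc : 0 < c) {s P : ℝ} {v : BuyerType}
    (hv : v ∈ triangle c) :
    v ∈ bundleRegion (c * s) 0 c P ↔ s ≤ v.1 / c ∧ P < v.1 + v.2 := by
  rw [mem_bundleRegion, le_div_iff₀ hc, mul_comm]
  exact ⟨fun h => ⟨h.1, h.2.2.2⟩, fun h => ⟨h.1, hv.2.2, hv.1, h.2⟩⟩

lemma isOptimalMenu_menu (hc : 4 / 3 < c) :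
    IsOptimalMenu (triangle c) (uniformTriangle c)
      {((0, 0), 0), ((1 / c, 1), 2 / 3),
        ((1, 1), 2 / 3 * c - 1 / 3 * Real.sqrt (c * (c - 1)))} := by
  have hopt := optimalPricing_menu hc
  have hc0 := hopt.pos
  refine ⟨exists_implements _ (by simp) (by simp), fun m hm => ?_⟩
  have hIC : IsICIR (triangle c) m := by
    refine hm.isICIR (by simp) ?_
    have : c⁻¹ ≤ 1 := inv_le_one_of_one_le₀ hopt.one_le
    simp [this, hc0.le]
  refine ⟨hIC, fun m' hm' => hopt.revenue_le hIC hm' ?_ ?_ ?_⟩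
  · intro v hv
    have hvT := hopt.leftRegion_subset hv
    obtain ⟨h1, h2, h3, h4⟩ := utility_cases_of_implements_menu hm hvT
    have h5 := (mem_leftRegion_of_mem_triangle hc0 hvT).1 hv
    have h6 := (bundle_le_iff hc v).2 h5.1.le
    rcases h1 with h | h | h <;> linarith
  · intro v hv
    have hvT := hopt.bundleRegion_subset hv
    obtain ⟨h1, h2, h3, h4⟩ := utility_cases_of_implements_menu hm hvT
    have h5 := (mem_bundleRegion_of_mem_triangle hc0 hvT).1 hv
    have h6 := (le_bundle_iff hc v).2 h5.1
    rcases h1 with h | h | h <;> linarith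
  · intro v hvT hl hb
    obtain ⟨h1, h2, h3, h4⟩ := utility_cases_of_implements_menu hm hvT
    rw [mem_leftRegion_of_mem_triangle hc0 hvT] at hl
    rw [mem_bundleRegion_of_mem_triangle hc0 hvT] at hb
    rcases lt_or_ge (v.1 / c) (menuThreshold c) with h5 | h5
    · have h6 := (bundle_le_iff hc v).2 h5.le
      have h7 : v.1 / c + v.2 ≤ 2 / 3 := not_lt.1 fun h => hl ⟨h5, h⟩
      rcases h1 with h | h | h <;> linarith
    · have h6 := (le_bundle_iff hc v).2 h5
      have h7 := not_lt.1 fun h => hb ⟨h5, h⟩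
      rcases h1 with h | h | h <;> linarith

/-- Ties between optimal choices occur only on three lines, which are null, so tie-breaking cannot
affect revenue. -/
lemma ae_payment_eq (hc : 4 / 3 < c)
    (hm : Implements (triangle c) {((0, 0), 0), ((1 / c, 1), 2 / 3),
      ((1, 1), 2 / 3 * c - 1 / 3 * Real.sqrt (c * (c - 1)))} m) :
    ∀ᵐ v ∂volume.restrict (triangle c), (m v).2 =
      (leftRegion c (menuThreshold c)).indicator (fun _ => 2 / 3) v +
      (bundleRegion (c * menuThreshold c) 0 c
        (2 / 3 * c - 1 / 3 * Real.sqrt (c * (c - 1)))).indicator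
        (fun _ => 2 / 3 * c - 1 / 3 * Real.sqrt (c * (c - 1))) v := by
  have hc0 : 0 < c := by linarith
  have hb' := bundle_sub_eq hc
  have hle := bundle_le_iff hc
  have hge := le_bundle_iff hc
  set P := 2 / 3 * c - 1 / 3 * Real.sqrt (c * (c - 1))
  rw [ae_restrict_iff' (measurableSet_triangle c)]
  filter_upwards [measure_eq_zero_iff_ae_notMem.1 (volume_line_eq_zero c (2 / 3)),
    measure_eq_zero_iff_ae_notMem.1 (volume_line_eq_zero 1 P),
    measure_eq_zero_iff_ae_notMem.1 (volume_vertical_line_eq_zero (c * menuThreshold c))]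
    with v n1 n2 n3 hv
  have n1' : v.1 / c + v.2 ≠ 2 / 3 := n1
  have n2' : v.1 + v.2 ≠ P := by simpa using n2
  have n3' : v.1 / c ≠ menuThreshold c := by
    intro h; apply n3; simp only [← h]; field_simp
  obtain ⟨h1, h2, h3, h4⟩ := utility_cases_of_implements_menu hm hv
  have hL := mem_leftRegion_of_mem_triangle hc0 (s := menuThreshold c) hv
  have hW := mem_bundleRegion_of_mem_triangle hc0 (s := menuThreshold c) (P := P) hv
  rcases n3'.lt_or_gt with h5 | h5
  · have h6 := not_le.1 (mt (hge v).1 (not_le.2 h5))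
    rw [indicator_of_notMem (fun h => absurd (hW.1 h).1 (not_le.2 h5)), add_zero]
    rcases n1'.lt_or_gt with h7 | h7
    · rw [indicator_of_notMem (fun h => absurd (hL.1 h).2 (not_lt.2 h7.le))]
      rcases h1 with h | h | h
      · exact h.2
      · linarith
      · linarith
    · rw [indicator_of_mem (hL.2 ⟨h5, h7⟩)]
      rcases h1 with h | h | h
      · linarith
      · exact h.2
      · linarith
  · have h6 := not_le.1 (mt (hle v).1 (not_le.2 h5))
    rw [indicator_of_notMem (fun h => absurd (hL.1 h).1 (not_lt.2 h5.le)), zero_add]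
    rcases n2'.lt_or_gt with h7 | h7
    · rw [indicator_of_notMem (fun h => absurd (hW.1 h).2 (not_lt.2 h7.le))]
      rcases h1 with h | h | h
      · exact h.2
      · linarith
      · linarith
    · rw [indicator_of_mem (hW.2 ⟨h5.le, h7⟩)]
      rcases h1 with h | h | h
      · linarith
      · linarith
      · exact h.2

lemma revenue_menu (hc : 4 / 3 < c)
    (hm : Implements (triangle c) {((0, 0), 0), ((1 / c, 1), 2 / 3),
      ((1, 1), 2 / 3 * c - 1 / 3 * Real.sqrt (c * (c - 1)))} m) :
    revenue (uniformTriangle c) m = 2 / 27 * (4 + c + Real.sqrt (c * (c - 1))) := by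
  have hopt := optimalPricing_menu hc
  have hc0 := hopt.pos
  have := isFiniteMeasure_restrict_triangle hc0
  have hs1 : 0 ≤ 1 - menuThreshold c := by linarith [hopt.le_third]
  have hLm := measurableSet_leftRegion c (menuThreshold c)
  have hWm := measurableSet_bundleRegion (c * menuThreshold c) 0 c
    (2 / 3 * c - 1 / 3 * Real.sqrt (c * (c - 1)))
  rw [revenue_uniformTriangle hc0, integral_congr_ae (ae_payment_eq hc hm),
    integral_add ((integrable_const _).indicator hLm) ((integrable_const _).indicator hWm),
    integral_indicator hLm, integral_indicator hWm, setIntegral_const, setIntegral_const,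
    Measure.real, Measure.real, Measure.restrict_apply hLm, Measure.restrict_apply hWm,
    inter_eq_left.2 hopt.leftRegion_subset, inter_eq_left.2 hopt.bundleRegion_subset,
    hopt.volume_leftRegion, hopt.volume_bundleRegion_self,
    ENNReal.toReal_ofReal (mul_nonneg (by linarith) hopt.nonneg),
    ENNReal.toReal_ofReal (mul_nonneg (by linarith) hs1), smul_eq_mul, smul_eq_mul]
  have hsq : Real.sqrt (c * (c - 1)) ^ 2 = c * (c - 1) := Real.sq_sqrt (by nlinarith)
  have hne : c - 1 ≠ 0 := by linarith
  rw [menuThreshold]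
  field_simp
  linear_combination (-27) * hsq

end Menu

end TriangleAuction

end

theorem mainTheorem1 (c : ℝ) (hc : 1 ≤ c) :
    -- the expected revenue of every IC and IR mechanism is well defined
    (∀ m : TriangleAuction.BuyerType → TriangleAuction.Outcome,
      TriangleAuction.IsICIR (TriangleAuction.triangle c) m →
        MeasureTheory.Integrable (fun v => (m v).2) (TriangleAuction.uniformTriangle c)) ∧
    (c ≤ 4 / 3 →
      TriangleAuction.IsOptimalMenu (TriangleAuction.triangle c)
        (TriangleAuction.uniformTriangle c)
        {((0, 0), 0), ((1, 1), Real.sqrt (c / 3))}) ∧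
    (4 / 3 < c →
      TriangleAuction.IsOptimalMenu (TriangleAuction.triangle c)
        (TriangleAuction.uniformTriangle c)
        {((0, 0), 0), ((1 / c, 1), 2 / 3),
          ((1, 1), 2 / 3 * c - 1 / 3 * Real.sqrt (c * (c - 1)))} ∧
      ∀ m : TriangleAuction.BuyerType → TriangleAuction.Outcome,
        TriangleAuction.Implements (TriangleAuction.triangle c)
          {((0, 0), 0), ((1 / c, 1), 2 / 3),
            ((1, 1), 2 / 3 * c - 1 / 3 * Real.sqrt (c * (c - 1)))} m →
        TriangleAuction.revenue (TriangleAuction.uniformTriangle c) m =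
          2 / 27 * (4 + c + Real.sqrt (c * (c - 1)))) :=
  ⟨fun _ h => h.integrable_payment (by linarith),
    fun h => TriangleAuction.isOptimalMenu_bundle hc h,
    fun h => ⟨TriangleAuction.isOptimalMenu_menu h, fun _ hm => TriangleAuction.revenue_menu h hm⟩⟩
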